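/- **Setting.** Let $G=(V,E)$ be a finite directed graph with $n=|V|$ nodes, and let $f$ be an integer with $n>f>0$. For $F\subseteq V$ let $G_F$ be the subgraph of $G$ induced by $V\setminus F$; for $u\in V\setminus F$ let $\mathrm{reach}_u(F)$ be the set of all nodes $w\in V\setminus F$ that have a directed path to $u$ in $G_F$ (in particular $u\in \mathrm{reach}_u(F)$). The graph satisfies the *2-reach condition with parameter $\rho$* if for all $F_1,F_2\subseteq V$ with $|F_1|,|F_2|\le f$ and all $u\in V\setminus F_1$, $v\in V\setminus F_2$ we have $|\mathrm{reach}_u(F_1)\cap \mathrm{reach}_v(F_2)|\ge\rho$. *Asynchronous system with authentication.* A node $u$ can send messages directly to $v$ iff $(u,v)\in E$. Links are reliable: every message sent to a non-faulty node is delivered exactly once, after an arbitrary finite delay and in arbitrary order; the recipient knows the link on which it arrives. Every node $u$ has an input $x_u\in I$, where $I\subset\mathbb R$ is a set of admissible inputs with minimum $a$ and maximum $b$, $a<b$ (for instance binary inputs $I=\{0,1\}$, or $I=[0,1]$). A deterministic algorithm, which may depend on $G,f,I,\varepsilon$, prescribes the messages that a node sends, and an irrevocable real output, as a function of the node's identity,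 input and local history; non-faulty nodes take infinitely many steps. Messages are built from atomic data by pairing and by idealized digital signatures: from a set of known messages one can extract components and signed contents, pair messages, use arbitrary atomic data, and sign with one's own private key, but a signature of another node can only be copied from a known message. Non-faulty nodes follow the algorithm, which uses only the node's own key and the messages it has received. A set $F$ of at most $f$ nodes may be Byzantine: at any time they may send over their outgoing links any messages that can be produced from what the nodes of $F$ have received together with the private keys of the nodes of $F$. *$\varepsilon$-approximate Byzantine consensus is possible in $G$* if some algorithm satisfies, in every execution with at most $f$ Byzantine nodes: (termination) each non-faulty node eventually outputs a value; (validity) the output of each non-faulty node lies in the convex hull of the inputs of the non-faulty nodes; ($\varepsilon$-agreement) the outputs of any two non-faulty nodes differ by at most $\varepsilon$. **Theorem.** Asynchronous $\varepsilon$-approximate Byzantine consensus with message authentication is possible in $G$ for every $\varepsilon>0$ if and only if $G$ satisfies the 2-reach condition with $\rho=f+1$. Moreover, for each fixed $\varepsilon$ with $0<\varepsilon<b-a$, it is possible in $G$ for that $\varepsilon$ if and only if $G$ satisfies the 2-reach condition with $\rho=f+1$. -/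

import Mathlib

/-! ## Graph conditions -/

/-- `reachSet G F u` is the set of the nodes outside `F` that have a directed path to `u` in the
subgraph of `G` induced by the complement of `F` (the path of length zero included). -/
def reachSet {V : Type*} (G : Digraph V) (F : Finset V) (u : V) : Set V :=
  {w | w ∉ F ∧ Relation.ReflTransGen (fun p q => G.Adj p q ∧ p ∉ F ∧ q ∉ F) w u}

/-- The 2-reach condition with parameter `ρ`, for at most `f` faults. -/
def TwoReach {V : Type*} (G : Digraph V) (f ρ : ℕ) : Prop :=
  ∀ F₁ F₂ : Finset V, F₁.card ≤ f → F₂.card ≤ f → ∀ u v : V, u ∉ F₁ → v ∉ F₂ →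
    ρ ≤ (reachSet G F₁ u ∩ reachSet G F₂ v).ncard

/-! ## Messages with ideal digital signatures -/

/-- Messages: atomic data, pairs, and `sign u m`, the message `m` together with the signature of
node `u` on `m`. -/
inductive Msg (V : Type*) (D : Type*) where
  | data (d : D) : Msg V D
  | pair (m₁ m₂ : Msg V D) : Msg V D
  | sign (u : V) (m : Msg V D) : Msg V D

/-- `Derivable C K m`: whoever knows the messages in `K` and holds the private keys of the nodes
in `C` can produce the message `m`. Signatures of nodes outside `C` cannot be forged: they can
only be copied from known messages. -/
inductive Derivable {V D : Type*} (C : Set V) (K : Set (Msg V D)) : Msg V D → Prop where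
  | known {m : Msg V D} (h : m ∈ K) : Derivable C K m
  | data (d : D) : Derivable C K (Msg.data d)
  | pair {m₁ m₂ : Msg V D} (h₁ : Derivable C K m₁) (h₂ : Derivable C K m₂) :
      Derivable C K (Msg.pair m₁ m₂)
  | fst {m₁ m₂ : Msg V D} (h : Derivable C K (Msg.pair m₁ m₂)) : Derivable C K m₁
  | snd {m₁ m₂ : Msg V D} (h : Derivable C K (Msg.pair m₁ m₂)) : Derivable C K m₂
  | sign {u : V} {m : Msg V D} (hu : u ∈ C) (h : Derivable C K m) : Derivable C K (Msg.sign u m)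
  | content {u : V} {m : Msg V D} (h : Derivable C K (Msg.sign u m)) : Derivable C K m

/-! ## Asynchronous algorithms -/

/-- The local history of a node, most recent step first. Each step is either an internal step
(`none`) or the receipt of a message from an incoming neighbour (`some (sender, message)`). -/
abbrev History (V : Type*) (D : Type*) := List (Option (V × Msg V D))

/-- The messages received in a local history. -/
def received {V D : Type*} (h : History V D) : Set (Msg V D) :=
  {m | ∃ u : V, some (u, m) ∈ h}

/-- A deterministic message-passing algorithm on `G`. What a node does in a step depends on its
identity, its input and its local history only (so memory is unbounded and the graph is known).
Messages go to outgoing neighbours, and are produced from the messages received so far with the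
node's own private key. An output is never changed. -/
structure Algorithm {V : Type*} (G : Digraph V) (D : Type*) where
  /-- `send v x h`: the pairs (recipient, message) that node `v` with input `x` sends in the step
  after which its local history is `h`. -/
  send : V → ℝ → History V D → List (V × Msg V D)
  /-- `output v x h`: the output of `v` with input `x` at local history `h`, if already chosen. -/
  output : V → ℝ → History V D → Option ℝ
  send_adj : ∀ v x h, ∀ p ∈ send v x h, G.Adj v p.1
  send_derivable : ∀ v x h, ∀ p ∈ send v x h, Derivable {v} (received h) p.2
  output_stable : ∀ v x h e y, output v x h = some y → output v x (e :: h) = some y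

/-! ## Executions -/

/-- A global configuration: the local histories, and the multiset of the messages in transit as
triples (sender, recipient, message). -/
structure Config (V : Type*) (D : Type*) where
  hist : V → History V D
  net : Multiset (V × V × Msg V D)

/-- Events: an internal step of `v`; the delivery to `v` of the message `m` sent by `u`; the
sending of an arbitrary message `m` by the faulty node `b` to `v`. -/
inductive Event (V : Type*) (D : Type*) where
  | internal (v : V) : Event V D
  | deliver (u v : V) (m : Msg V D) : Event V D
  | inject (b v : V) (m : Msg V D) : Event V D

/-- The node that takes a step of its own in an event (`none` for the sending by a faulty node). -/
def Event.actor {V D : Type*} : Event V D → Option V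
  | .internal v => some v
  | .deliver _ v _ => some v
  | .inject _ _ _ => none

open Classical in
/-- Node `v` takes the step `e`: its local history is extended, and if it is not faulty, it sends
the messages that the algorithm prescribes. -/
noncomputable def Config.advance {V D : Type*} {G : Digraph V} (A : Algorithm G D) (x : V → ℝ)
    (F : Finset V) (c : Config V D) (v : V) (e : Option (V × Msg V D)) : Config V D where
  hist := Function.update c.hist v (e :: c.hist v)
  net := c.net + if v ∈ F then 0 else
    ((A.send v (x v) (e :: c.hist v)).map fun p => (v, p.1, p.2) : Multiset (V × V × Msg V D))

/-- `Step A x F e c c'`: in an execution of `A` with inputs `x` and set `F` of Byzantine nodes,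
the event `e` can lead from configuration `c` to `c'`. A delivery takes one copy of the
message out of the network. A faulty node can send, along its outgoing links and at any time,
every message that the faulty nodes together can derive from what they have received and from
their private keys. -/
inductive Step {V D : Type*} {G : Digraph V} (A : Algorithm G D) (x : V → ℝ) (F : Finset V) :
    Event V D → Config V D → Config V D → Prop where
  | internal (c : Config V D) (v : V) : Step A x F (.internal v) c (c.advance A x F v none)
  | deliver (c : Config V D) (u v : V) (m : Msg V D) (rest : Multiset (V × V × Msg V D))
      (h : c.net = (u, v, m) ::ₘ rest) :
      Step A x F (.deliver u v m) c
        (Config.advance A x F { hist := c.hist, net := rest } v (some (u, m)))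
  | inject (c : Config V D) (b v : V) (m : Msg V D) (hb : b ∈ F) (hbv : G.Adj b v)
      (hm : Derivable (↑F) {m' | ∃ b' ∈ F, m' ∈ received (c.hist b')} m) :
      Step A x F (.inject b v m) c { hist := c.hist, net := (b, v, m) ::ₘ c.net }

/-- Admissible asynchronous executions with inputs `x` and set `F` of Byzantine nodes: infinite
sequences of steps from the configuration with empty histories and no message in transit, in which
every non-faulty node takes infinitely many steps and every message to a non-faulty node is
eventually delivered, after an arbitrary finite delay and in arbitrary order. (If a triple is in
transit in several copies, the last condition applies again after each delivery.) -/
structure Execution {V D : Type*} {G : Digraph V} (A : Algorithm G D) (x : V → ℝ)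
    (F : Finset V) where
  config : ℕ → Config V D
  event : ℕ → Event V D
  hist_zero : ∀ v, (config 0).hist v = []
  net_zero : (config 0).net = 0
  step : ∀ t, Step A x F (event t) (config t) (config (t + 1))
  live : ∀ v, v ∉ F → ∀ t, ∃ t', t ≤ t' ∧ (event t').actor = some v
  reliable : ∀ u v m, v ∉ F → ∀ t, (u, v, m) ∈ (config t).net →
    ∃ t', t ≤ t' ∧ event t' = .deliver u v m

/-- Node `v` has chosen the output `y` at some time of the execution. -/
def Execution.Outputs {V D : Type*} {G : Digraph V} {A : Algorithm G D} {x : V → ℝ}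
    {F : Finset V} (E : Execution A x F) (v : V) (y : ℝ) : Prop :=
  ∃ t, A.output v (x v) ((E.config t).hist v) = some y

/-! ## Approximate Byzantine consensus -/

/-- `A` achieves `ε`-approximate Byzantine consensus in the presence of up to `f` Byzantine faults,
for inputs in `I`: every admissible execution satisfies termination, validity and
`ε`-agreement. -/
structure AchievesConsensus {V D : Type*} {G : Digraph V} (A : Algorithm G D) (f : ℕ)
    (I : Set ℝ) (ε : ℝ) : Prop where
  termination : ∀ (x : V → ℝ) (F : Finset V), (∀ v, x v ∈ I) → F.card ≤ f →
    ∀ (E : Execution A x F) (v : V), v ∉ F → ∃ y, E.Outputs v y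
  validity : ∀ (x : V → ℝ) (F : Finset V), (∀ v, x v ∈ I) → F.card ≤ f →
    ∀ (E : Execution A x F) (v : V) (y : ℝ), v ∉ F → E.Outputs v y →
      y ∈ convexHull ℝ (x '' {w | w ∉ F})
  agreement : ∀ (x : V → ℝ) (F : Finset V), (∀ v, x v ∈ I) → F.card ≤ f →
    ∀ (E : Execution A x F) (v w : V) (y z : ℝ), v ∉ F → w ∉ F →
      E.Outputs v y → E.Outputs w z → |y - z| ≤ ε

/-- Asynchronous `ε`-approximate Byzantine consensus with message authentication is possible on
`G` (with up to `f` faults and inputs in `I`): some algorithm, over some type of atomic data,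
achieves it. -/
def ConsensusPossible {V : Type*} (G : Digraph V) (f : ℕ) (I : Set ℝ) (ε : ℝ) : Prop :=
  ∃ (D : Type) (A : Algorithm G D), AchievesConsensus A f I ε

/-! Necessity is an indistinguishability argument. Suppose two reach sets `R₁`, `R₂`, for removed
sets `F₁`, `F₂`, meet in a set `C` of at most `f` nodes. No edge enters `Rᵢ` except from `Rᵢ` or
`Fᵢ`, so when `Fᵢ` is silent, `Rᵢ` evolves without outside help; with all inputs equal to `a` (resp.
`b`), validity forces its nodes to output `a` (resp. `b`). Both runs can be replayed one after the
other in a single execution with Byzantine set `C`: the nodes of `C` play their honest roles in both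
runs, which needs only their own keys and the messages they received. The non-faulty nodes of `R₁`
and `R₂` then output `a` and `b`, so `|a - b| ≤ ε` (`AchievesConsensus.le_of_closedUpTo`). The
finite replay is completed to an admissible execution by a fair scheduler
(`Leads.exists_execution`).

Sufficiency comes from flooding signed claims. A node enters the next round once, for some `F` of
size at most `f`, it knows certified values of its whole reach set avoiding `F`. Taking for `F` the
actual faulty set shows that no round blocks (`Execution.exists_value`). A claim counts only
together with claims justifying it, down to round `0`, so a faulty node can equivocate between
admissible values but cannot invent others. Reach sets have at least `2f + 1` nodes, so one round of
trimming brings every certified value into the hull of the honest inputs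
(`Execution.accepted_mem_convexHull`); afterwards plain midpoints suffice. Any two reach sets share
a non-faulty node, whose value is unique by unforgeability, and this halves the spread in each later
round (`Execution.accepted_sub_le`). -/

/-! ## Fair executions -/

section Scheduling

variable {V D : Type*} {G : Digraph V}

/-- The configuration with empty histories and no message in transit. -/
def Config.init : Config V D := ⟨fun _ => [], 0⟩

/-- `e` is not the sending of a message by a faulty node. -/
def Event.IsHonest : Event V D → Prop
  | .internal _ => True
  | .deliver _ _ _ => True
  | .inject _ _ _ => False

/-- The message in transit that an event delivers. -/
def Event.triple : Event V D → Option (V × V × Msg V D)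
  | .internal _ => none
  | .deliver u v m => some (u, v, m)
  | .inject _ _ _ => none

/-- An infinite fair sequence of steps, from an arbitrary configuration. -/
structure FairRun (A : Algorithm G D) (x : V → ℝ) (F : Finset V) where
  config : ℕ → Config V D
  event : ℕ → Event V D
  step : ∀ t, Step A x F (event t) (config t) (config (t + 1))
  live : ∀ v, v ∉ F → ∀ t, ∃ t', t ≤ t' ∧ (event t').actor = some v
  reliable : ∀ u v m, v ∉ F → ∀ t, (u, v, m) ∈ (config t).net →
    ∃ t', t ≤ t' ∧ event t' = .deliver u v m

theorem Step.net_mem {A : Algorithm G D} {x : V → ℝ} {F : Finset V} {e : Event V D}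
    {c c' : Config V D} (h : Step A x F e c c') {u v : V} {m : Msg V D}
    (hm : (u, v, m) ∈ c.net) : e = .deliver u v m ∨ (u, v, m) ∈ c'.net := by
  cases h with
  | internal _ w => exact .inr (Multiset.mem_add.2 (.inl hm))
  | deliver _ u' v' m' rest h =>
    rw [h, Multiset.mem_cons] at hm
    rcases hm with hm | hm
    · left
      simp only [Prod.mk.injEq] at hm
      obtain ⟨rfl, rfl, rfl⟩ := hm
      rfl
    · exact .inr (Multiset.mem_add.2 (.inl hm))
  | inject _ b v _ hb hbv hm' => exact .inr (Multiset.mem_cons_of_mem hm)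

/-- A step followed by a fair run. -/
def FairRun.cons {A : Algorithm G D} {x : V → ℝ} {F : Finset V} (E : FairRun A x F)
    {e : Event V D} {c : Config V D} (h : Step A x F e c (E.config 0)) : FairRun A x F where
  config := fun t => Nat.casesOn t c E.config
  event := fun t => Nat.casesOn t e E.event
  step := by
    intro t
    cases t with
    | zero => exact h
    | succ t => exact E.step t
  live := by
    intro v hv t
    obtain ⟨t', ht, h'⟩ := E.live v hv t
    exact ⟨t' + 1, by omega, h'⟩
  reliable := by
    intro u v m hv t hm
    cases t with
    | zero =>
      rcases h.net_mem hm with h' | h'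
      · exact ⟨0, le_rfl, h'⟩
      · obtain ⟨t', -, h''⟩ := E.reliable u v m hv 0 h'
        exact ⟨t' + 1, by omega, h''⟩
    | succ t =>
      obtain ⟨t', ht, h''⟩ := E.reliable u v m hv t hm
      exact ⟨t' + 1, by omega, h''⟩

open Classical in
/-- The events that deliver the messages sent by `v` in a step. -/
noncomputable def deliveries (A : Algorithm G D) (x : V → ℝ) (F : Finset V) (v : V)
    (h : History V D) : List (Event V D) :=
  if v ∈ F then [] else (A.send v (x v) h).map fun p => .deliver v p.1 p.2

/-- One step of the first-in-first-out scheduler: the local histories and the queue of the pending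
events. -/
noncomputable def schedule (A : Algorithm G D) (x : V → ℝ) (F : Finset V) :
    (V → History V D) × List (Event V D) → (V → History V D) × List (Event V D)
  | (h, []) => (h, [])
  | (h, .internal v :: q) => by
      classical exact (Function.update h v (none :: h v),
        q ++ (.internal v :: deliveries A x F v (none :: h v)))
  | (h, .deliver u v m :: q) => by
      classical exact (Function.update h v (some (u, m) :: h v),
        q ++ deliveries A x F v (some (u, m) :: h v))
  | (h, .inject _ _ _ :: q) => (h, q)

/-- The configuration of a state of the scheduler. -/
def schedConfig (s : (V → History V D) × List (Event V D)) : Config V D :=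
  ⟨s.1, (s.2.filterMap Event.triple : List _)⟩

theorem filterMap_deliveries (A : Algorithm G D) (x : V → ℝ) (F : Finset V) (v : V)
    (h : History V D) [Decidable (v ∈ F)] :
    (((deliveries A x F v h).filterMap Event.triple : List _) : Multiset (V × V × Msg V D)) =
      if v ∈ F then 0 else
        ((A.send v (x v) h).map fun p => (v, p.1, p.2) : Multiset (V × V × Msg V D)) := by
  unfold deliveries
  split_ifs
  · rfl
  · rw [List.filterMap_map]
    congr 1
    rw [← List.filterMap_eq_map]
    rfl

theorem deliveries_isHonest (A : Algorithm G D) (x : V → ℝ) (F : Finset V) (v : V)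
    (h : History V D) : ∀ e ∈ deliveries A x F v h, e.IsHonest := by
  intro e he
  unfold deliveries at he
  split_ifs at he
  · simp at he
  · obtain ⟨p, -, rfl⟩ := List.mem_map.1 he
    trivial

theorem schedule_step (A : Algorithm G D) (x : V → ℝ) (F : Finset V) (h : V → History V D)
    (e : Event V D) (q : List (Event V D)) (he : e.IsHonest) :
    Step A x F e (schedConfig (h, e :: q)) (schedConfig (schedule A x F (h, e :: q))) := by
  cases e with
  | internal v =>
    convert Step.internal (A := A) (x := x) (F := F) (schedConfig (h, .internal v :: q)) v using 1
    simp only [schedConfig, schedule, Config.advance, List.filterMap_append, List.filterMap_cons,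
      Event.triple, ← filterMap_deliveries, Multiset.coe_add]
  | deliver u v m =>
    convert Step.deliver (A := A) (x := x) (F := F) (schedConfig (h, .deliver u v m :: q)) u v m
      (q.filterMap Event.triple : List _) rfl using 1
    simp only [schedConfig, schedule, Config.advance, List.filterMap_append,
      ← filterMap_deliveries, Multiset.coe_add]
  | inject => exact he.elim

/-- Fairness of the scheduler rests on two features: new events only join at the end, and a
processed internal event is put back, so each node always has a step pending. -/
theorem schedule_queue (A : Algorithm G D) (x : V → ℝ) (F : Finset V) (h : V → History V D)
    (e : Event V D) (q : List (Event V D)) :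
    ∃ l, (schedule A x F (h, e :: q)).2 = q ++ l ∧ (∀ v, e = .internal v → e ∈ l) ∧
      ∀ e' ∈ l, e'.IsHonest := by
  cases e with
  | internal v =>
    refine ⟨_, rfl, fun _ _ => by simp, ?_⟩
    intro e' he'
    rcases List.mem_cons.1 he' with rfl | he'
    · trivial
    · exact deliveries_isHonest _ _ _ _ _ _ he'
  | deliver u v m =>
    exact ⟨_, rfl, by simp, deliveries_isHonest _ _ _ _ _⟩
  | inject => exact ⟨[], by simp [schedule], by simp, by simp⟩

/-- Every configuration starts a fair run in which the faulty nodes send nothing. -/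
theorem exists_fairRun [Fintype V] [Nonempty V] (A : Algorithm G D) (x : V → ℝ) (F : Finset V)
    (c : Config V D) : ∃ E : FairRun A x F, E.config 0 = c ∧ ∀ t, (E.event t).IsHonest := by
  classical
  let q₀ : List (Event V D) := (Finset.univ.toList : List V).map Event.internal ++
    c.net.toList.map fun p => Event.deliver p.1 p.2.1 p.2.2
  let s : ℕ → (V → History V D) × List (Event V D) := fun t => (schedule A x F)^[t] (c.hist, q₀)
  have hs : ∀ t, s (t + 1) = schedule A x F (s t) := fun t => Function.iterate_succ_apply' _ _ _
  have hq : ∀ t, (∀ v, Event.internal v ∈ (s t).2) ∧ ∀ e ∈ (s t).2, e.IsHonest := by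
    intro t
    induction t with
    | zero =>
      refine ⟨fun v => by simp [s, q₀], fun e he => ?_⟩
      rcases List.mem_append.1 he with he | he
      · obtain ⟨v, -, rfl⟩ := List.mem_map.1 he
        trivial
      · obtain ⟨v, -, rfl⟩ := List.mem_map.1 he
        trivial
    | succ t ih =>
      rw [hs]
      generalize s t = st at ih
      obtain ⟨h, q⟩ := st
      cases q with
      | nil => simp at ih
      | cons e q =>
        obtain ⟨l, hl, h1, h2⟩ := schedule_queue A x F h e q
        rw [hl]
        refine ⟨fun v => ?_, fun e' he' => ?_⟩
        · rcases List.mem_cons.1 (ih.1 v) with h' | h'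
          · exact List.mem_append.2 (.inr (h' ▸ h1 v h'.symm))
          · exact List.mem_append.2 (.inl h')
        · rcases List.mem_append.1 he' with h' | h'
          · exact ih.2 e' (List.mem_cons_of_mem _ h')
          · exact h2 e' h'
  have hcons : ∀ t, ∃ e q, s t = ((s t).1, e :: q) := by
    intro t
    have h := (hq t).1 (Classical.arbitrary V)
    generalize s t = st at h
    obtain ⟨h', q⟩ := st
    cases q with
    | nil => simp at h
    | cons e q => exact ⟨e, q, rfl⟩
  choose ev tl hev using hcons
  have htl : ∀ t, ∃ l, (s (t + 1)).2 = tl t ++ l := by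
    intro t
    rw [hs, hev t]
    obtain ⟨l, hl, -⟩ := schedule_queue A x F (s t).1 (ev t) (tl t)
    exact ⟨l, hl⟩
  -- Since events are only appended, the entry at position `i` moves up one place per step and is
  -- processed exactly `i` steps later.
  have hproc : ∀ i t (e : Event V D), (s t).2[i]? = some e → ev (t + i) = e := by
    intro i
    induction i with
    | zero =>
      intro t e he
      rw [hev t] at he
      simpa using he
    | succ i ih =>
      intro t e he
      rw [hev t] at he
      have he' : (tl t)[i]? = some e := by simpa using he
      obtain ⟨l, hl⟩ := htl t
      have := ih (t + 1) e (by
        rw [hl, List.getElem?_append_left (List.getElem?_eq_some_iff.1 he').1]; exact he')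
      rwa [show t + (i + 1) = t + 1 + i by omega]
  have hmem : ∀ t (e : Event V D), e ∈ (s t).2 → ∃ t', t ≤ t' ∧ ev t' = e := by
    intro t e he
    obtain ⟨i, hi⟩ := List.mem_iff_getElem?.1 he
    exact ⟨t + i, by omega, hproc i t e hi⟩
  have hhon : ∀ t, (ev t).IsHonest := fun t => (hq t).2 _ (by rw [hev t]; simp)
  refine ⟨⟨fun t => schedConfig (s t), ev, fun t => ?_, fun v _ t => ?_, fun u v m _ t h => ?_⟩,
    ?_, hhon⟩
  · have := schedule_step A x F (s t).1 (ev t) (tl t) (hhon t)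
    rw [hs]
    rwa [← hev t] at this
  · obtain ⟨t', ht, h⟩ := hmem t _ ((hq t).1 v)
    exact ⟨t', ht, by rw [h]; rfl⟩
  · apply hmem
    obtain ⟨e, he, h⟩ := List.mem_filterMap.1 (Multiset.mem_coe.1 h)
    cases e with
    | deliver u' v' m' =>
      simp only [Event.triple, Option.some.injEq, Prod.mk.injEq] at h
      obtain ⟨rfl, rfl, rfl⟩ := h
      exact he
    | _ => simp [Event.triple] at h
  · have h1 : (q₀.filterMap Event.triple) = c.net.toList := by
      simp only [q₀, List.filterMap_append, List.filterMap_map]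
      have h2 : ∀ l : List V, l.filterMap (Event.triple (D := D) ∘ Event.internal) = [] :=
        fun l => List.filterMap_eq_nil_iff.2 fun _ _ => rfl
      have h3 : ∀ l : List (V × V × Msg V D), l.filterMap
          (Event.triple ∘ fun p => Event.deliver p.1 p.2.1 p.2.2) = l :=
        fun l => List.filterMap_some
      rw [h2, h3, List.nil_append]
    show schedConfig (c.hist, q₀) = c
    unfold schedConfig
    rw [h1, Multiset.coe_toList]

/-- `c'` can be reached from `c`. -/
def Leads (A : Algorithm G D) (x : V → ℝ) (F : Finset V) : Config V D → Config V D → Prop :=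
  Relation.ReflTransGen fun c c' => ∃ e, Step A x F e c c'

/-- The finite run is prepended, step by step from its end, to a fair run starting at `c`; this is
why `FairRun` allows an arbitrary initial configuration. -/
theorem Leads.exists_execution [Fintype V] [Nonempty V] {A : Algorithm G D} {x : V → ℝ}
    {F : Finset V} {c : Config V D} (h : Leads A x F .init c) :
    ∃ (E : Execution A x F) (T : ℕ), E.config T = c := by
  have key : ∃ (E : FairRun A x F) (T : ℕ), E.config 0 = .init ∧ E.config T = c := by
    unfold Leads at h
    generalize Config.init = c₀ at h
    induction h using Relation.ReflTransGen.head_induction_on with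
    | refl =>
      obtain ⟨E, hE, -⟩ := exists_fairRun A x F c
      exact ⟨E, 0, hE, hE⟩
    | head h _ ih =>
      obtain ⟨E, T, h0, hT⟩ := ih
      obtain ⟨e, he⟩ := h
      rw [← h0] at he
      exact ⟨E.cons he, T + 1, rfl, hT⟩
  obtain ⟨E, T, h0, hT⟩ := key
  exact ⟨⟨E.config, E.event, by rw [h0]; exact fun _ => rfl, by rw [h0]; rfl, E.step, E.live,
    E.reliable⟩, T, hT⟩

theorem exists_honest_execution [Fintype V] [Nonempty V] (A : Algorithm G D) (x : V → ℝ)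
    (F : Finset V) : ∃ E : Execution A x F, ∀ t, (E.event t).IsHonest := by
  obtain ⟨E, h0, h⟩ := exists_fairRun A x F .init
  exact ⟨⟨E.config, E.event, by rw [h0]; exact fun _ => rfl, by rw [h0]; rfl, E.step, E.live,
    E.reliable⟩, h⟩

end Scheduling

/-! ## Necessity of the reach condition -/

theorem Derivable.mono {V D : Type*} {C C' : Set V} {K K' : Set (Msg V D)} (hC : C ⊆ C')
    (hK : K ⊆ K') {m : Msg V D} (h : Derivable C K m) : Derivable C' K' m := by
  induction h with
  | known h => exact .known (hK h)
  | data d => exact .data d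
  | pair _ _ h₁ h₂ => exact .pair h₁ h₂
  | fst _ h => exact .fst h
  | snd _ h => exact .snd h
  | sign hu _ h => exact .sign (hC hu) h
  | content _ h => exact .content h

section Necessity

variable {V D : Type*} {G : Digraph V}

/-- All incoming edges of `R` come from `R` or `F`, and `F` is disjoint from `R`. -/
def ClosedUpTo (G : Digraph V) (R : Set V) (F : Finset V) : Prop :=
  (∀ p q, q ∈ R → G.Adj p q → p ∈ R ∨ p ∈ F) ∧ ∀ p ∈ R, p ∉ F

theorem closedUpTo_reachSet (G : Digraph V) (F : Finset V) (u : V) :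
    ClosedUpTo G (reachSet G F u) F := by
  refine ⟨fun p q hq hpq => ?_, fun p hp => hp.1⟩
  by_cases hp : p ∈ F
  · exact .inr hp
  · exact .inl ⟨hp, .head ⟨hpq, hp, hq.1⟩ hq.2⟩

open Classical in
/-- The configuration `c'`, in which the nodes of `C` are faulty, looks on `R` at least as `c`. -/
structure Mimics (R : Set V) (C : Finset V) (c c' : Config V D) : Prop where
  hist : ∀ w ∈ R, w ∉ C → c'.hist w = c.hist w
  received : ∀ w ∈ R, received (c.hist w) ⊆ received (c'.hist w)
  net : c.net.filter (fun p => p.2.1 ∈ R) ≤ c'.net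

theorem received_cons_mono {h h' : History V D} (hh : received h ⊆ received h')
    (e : Option (V × Msg V D)) : received (e :: h) ⊆ received (e :: h') := by
  rintro m ⟨u, hu⟩
  rcases List.mem_cons.1 hu with hu | hu
  · exact ⟨u, List.mem_cons.2 (.inl hu)⟩
  · obtain ⟨u', hu'⟩ := hh ⟨u, hu⟩
    exact ⟨u', List.mem_cons_of_mem _ hu'⟩

theorem leads_inject (A : Algorithm G D) (x : V → ℝ) (C : Finset V) (c : Config V D) (b : V)
    (hb : b ∈ C) (l : List (V × Msg V D)) (hl : ∀ p ∈ l, G.Adj b p.1 ∧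
      Derivable (↑C) {m' | ∃ b' ∈ C, m' ∈ received (c.hist b')} p.2) :
    Leads A x C c ⟨c.hist, c.net + (l.map fun p => (b, p.1, p.2) : List _)⟩ := by
  induction l with
  | nil =>
    have : c = ⟨c.hist, c.net + (List.map (fun p : V × Msg V D => (b, p.1, p.2)) [] : List _)⟩ := by
      simp
    rw [← this]
    exact .refl
  | cons p l ih =>
    refine (ih fun p hp => hl p (List.mem_cons_of_mem _ hp)).tail ⟨.inject b p.1 p.2, ?_⟩
    obtain ⟨h1, h2⟩ := hl p List.mem_cons_self
    have := Step.inject (A := A) (x := x) (F := C)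
      ⟨c.hist, c.net + (l.map fun p => (b, p.1, p.2) : List _)⟩ b p.1 p.2 hb h1 h2
    convert this using 2
    rw [List.map_cons, ← Multiset.cons_coe, Multiset.add_cons]

/-- A node of `R` takes a step in both configurations. -/
theorem Mimics.advance {A : Algorithm G D} {x y : V → ℝ} {R : Set V} {F C : Finset V}
    (hR : ClosedUpTo G R F) (hxy : ∀ w ∈ R, w ∉ C → y w = x w) {c d : Config V D}
    (h : Mimics R C c d) {v : V} (hv : v ∈ R) (e : Option (V × Msg V D)) :
    ∃ d', Leads A y C (d.advance A y C v e) d' ∧ Mimics R C (c.advance A x F v e) d' ∧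
      d'.hist = (d.advance A y C v e).hist := by
  classical
  have hvF : v ∉ F := hR.2 v hv
  have hist : ∀ w ∈ R, w ∉ C →
      (d.advance A y C v e).hist w = (c.advance A x F v e).hist w := by
    intro w hw hwC
    by_cases hwv : w = v
    · subst hwv
      simp [Config.advance, h.hist w hw hwC]
    · simp [Config.advance, Function.update_of_ne hwv, h.hist w hw hwC]
  have hrec : ∀ w ∈ R, _root_.received ((c.advance A x F v e).hist w) ⊆
      _root_.received ((d.advance A y C v e).hist w) := by
    intro w hw
    by_cases hwv : w = v
    · subst hwv
      simpa [Config.advance] using received_cons_mono (h.received w hw) e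
    · simpa [Config.advance, Function.update_of_ne hwv] using h.received w hw
  by_cases hvC : v ∈ C
  -- A faulty `v` sends nothing when it steps, so the messages prescribed in the original run are
  -- injected. They are derivable because `v` holds its own key and has received at least as much as
  -- there.
  · refine ⟨_, leads_inject A y C _ v hvC (A.send v (x v) (e :: c.hist v)) ?_, ⟨hist, hrec, ?_⟩,
      rfl⟩
    · intro p hp
      refine ⟨A.send_adj _ _ _ p hp, (A.send_derivable _ _ _ p hp).mono ?_ ?_⟩
      · simpa using hvC
      · intro m hm
        refine ⟨v, hvC, hrec v hv ?_⟩
        simpa [Config.advance] using hm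
    · simp only [Config.advance, hvF, hvC, if_true, if_false, add_zero, Multiset.filter_add]
      exact add_le_add h.net (Multiset.filter_le _ _)
  · refine ⟨_, .refl, ⟨hist, hrec, ?_⟩, rfl⟩
    simp only [Config.advance, hvF, hvC, if_false, Multiset.filter_add, h.hist v hv hvC,
      hxy v hv hvC]
    exact add_le_add h.net (Multiset.filter_le _ _)

/-- A node outside `R` is either in `F`, hence silent, or has no edge into `R`; its step is
invisible on `R` and needs no counterpart. -/
theorem Mimics.advance_outside {A : Algorithm G D} {x : V → ℝ} {R : Set V} {F C : Finset V}
    (hR : ClosedUpTo G R F) {c d : Config V D} (h : Mimics R C c d) {v : V} (hv : v ∉ R)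
    (e : Option (V × Msg V D)) : Mimics R C (c.advance A x F v e) d := by
  classical
  have hw' : ∀ w ∈ R, (c.advance A x F v e).hist w = c.hist w := by
    intro w hw
    have : w ≠ v := fun h => hv (h ▸ hw)
    simp [Config.advance, Function.update_of_ne this]
  refine ⟨fun w hw hwC => by rw [hw' w hw, h.hist w hw hwC],
    fun w hw => by rw [hw' w hw]; exact h.received w hw, ?_⟩
  simp only [Config.advance, Multiset.filter_add]
  suffices hz : Multiset.filter (fun p : V × V × Msg V D => p.2.1 ∈ R) (if v ∈ F then 0 else
      ((A.send v (x v) (e :: c.hist v)).map fun p => (v, p.1, p.2) :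
        Multiset (V × V × Msg V D))) = 0 by
    rw [hz, add_zero]
    exact h.net
  split_ifs with hvF
  · simp
  · rw [Multiset.filter_eq_nil]
    intro p hp hpR
    obtain ⟨p', hp', rfl⟩ := List.mem_map.1 (Multiset.mem_coe.1 hp)
    exact (hR.1 v p'.1 hpR (A.send_adj _ _ _ p' hp')).elim hv hvF

theorem Mimics.step {A : Algorithm G D} {x y : V → ℝ} {R : Set V} {F C : Finset V}
    (hR : ClosedUpTo G R F) (hxy : ∀ w ∈ R, w ∉ C → y w = x w) {c c' d : Config V D}
    (h : Mimics R C c d) {e : Event V D} (he : e.IsHonest) (hs : Step A x F e c c') :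
    ∃ d', Leads A y C d d' ∧ Mimics R C c' d' ∧ ∀ w ∉ R, d'.hist w = d.hist w := by
  classical
  have hout : ∀ (d₀ : Config V D) (v : V) (e : Option (V × Msg V D)), v ∈ R → ∀ w ∉ R,
      (d₀.advance A y C v e).hist w = d₀.hist w := by
    intro d₀ v e hv w hw
    have : w ≠ v := fun h => hw (h ▸ hv)
    simp [Config.advance, Function.update_of_ne this]
  cases hs with
  | inject => exact he.elim
  | internal _ v =>
    by_cases hv : v ∈ R
    · obtain ⟨d', h1, h2, h3⟩ := h.advance (A := A) hR hxy hv none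
      exact ⟨d', .head ⟨_, .internal d v⟩ h1, h2, fun w hw => by rw [h3, hout _ _ _ hv w hw]⟩
    · exact ⟨d, .refl, h.advance_outside hR hv none, fun _ _ => rfl⟩
  | deliver _ u v m rest hnet =>
    by_cases hv : v ∈ R
    · have hle := h.net
      rw [hnet, Multiset.filter_cons_of_pos _ (by exact hv)] at hle
      obtain ⟨r, hr⟩ := Multiset.exists_cons_of_mem (Multiset.mem_of_le hle
        (Multiset.mem_cons_self _ _))
      rw [hr, Multiset.cons_le_cons_iff] at hle
      have h' : Mimics R C ⟨c.hist, rest⟩ ⟨d.hist, r⟩ := ⟨h.hist, h.received, by convert hle⟩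
      obtain ⟨d', h1, h2, h3⟩ := h'.advance (A := A) hR hxy hv (some (u, m))
      exact ⟨d', .head ⟨_, .deliver d u v m r hr⟩ h1, h2,
        fun w hw => by rw [h3, hout _ _ _ hv w hw]⟩
    · refine ⟨d, .refl, Mimics.advance_outside (c := ⟨c.hist, rest⟩) hR
        ⟨h.hist, h.received, ?_⟩ hv _, fun _ _ => rfl⟩
      have hle := h.net
      rw [hnet, Multiset.filter_cons_of_neg _ (by exact hv)] at hle
      convert hle

/-- The start `d` is arbitrary apart from empty histories at the non-faulty nodes of `R`, so a
second simulation can follow a first one: leftover messages in transit are harmless because `Mimics`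
only asks for inclusion. The last conjunct preserves the outcome of the first simulation outside the
second region. -/
theorem exists_leads_mimics {A : Algorithm G D} {x y : V → ℝ} {R : Set V} {F C : Finset V}
    (hR : ClosedUpTo G R F) (hxy : ∀ w ∈ R, w ∉ C → y w = x w) (E : Execution A x F)
    (hE : ∀ t, (E.event t).IsHonest) (d : Config V D) (hd : ∀ w ∈ R, w ∉ C → d.hist w = [])
    (t : ℕ) :
    ∃ d', Leads A y C d d' ∧ Mimics R C (E.config t) d' ∧ ∀ w ∉ R, d'.hist w = d.hist w := by
  induction t with
  | zero =>
    refine ⟨d, .refl, ⟨fun w hw hwC => ?_, fun w _ => ?_, ?_⟩, fun _ _ => rfl⟩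
    · rw [hd w hw hwC, E.hist_zero]
    · rw [E.hist_zero]
      rintro m ⟨u, hu⟩
      simp at hu
    · rw [E.net_zero]
      simp
  | succ t ih =>
    obtain ⟨d₁, h1, h2, h3⟩ := ih
    obtain ⟨d₂, h4, h5, h6⟩ := h2.step hR hxy (hE t) (E.step t)
    exact ⟨d₂, h1.trans h4, h5, fun w hw => by rw [h6 w hw, h3 w hw]⟩

/-- If all nodes have the input `a` and the nodes of `F` are silent, then every other node
outputs `a`. -/
theorem AchievesConsensus.outputs_const [Fintype V] [Nonempty V] {A : Algorithm G D} {f : ℕ}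
    {I : Set ℝ} {ε : ℝ} (hA : AchievesConsensus A f I ε) {a : ℝ} (ha : a ∈ I) {F : Finset V}
    (hF : F.card ≤ f) {u : V} (hu : u ∉ F) (E : Execution A (fun _ => a) F) :
    E.Outputs u a := by
  obtain ⟨y, hy⟩ := hA.termination _ F (fun _ => ha) hF E u hu
  have := hA.validity _ F (fun _ => ha) hF E u y hu hy
  have h2 : y ∈ convexHull ℝ {a} := convexHull_mono (by rintro _ ⟨w, -, rfl⟩; rfl) this
  rw [convexHull_singleton] at h2
  obtain rfl : y = a := h2
  exact hy

/-- Execution `E₁` is replayed on `R₁` up to the output of `u`, then `E₂` on `R₂` up to the output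
of `v`. Because `R₁ ∩ R₂ ⊆ C`, the non-faulty nodes of `R₂` are untouched by the first replay and
those of `R₁` by the second. -/
theorem AchievesConsensus.le_of_closedUpTo [Fintype V] {A : Algorithm G D} {f : ℕ} {I : Set ℝ}
    {ε : ℝ} (hA : AchievesConsensus A f I ε) {a b : ℝ} (ha : a ∈ I) (hb : b ∈ I)
    {R₁ R₂ : Set V} {F₁ F₂ C : Finset V} (hR₁ : ClosedUpTo G R₁ F₁) (hR₂ : ClosedUpTo G R₂ F₂)
    (hF₁ : F₁.card ≤ f) (hF₂ : F₂.card ≤ f) (hC : C.card ≤ f) (hRC : R₁ ∩ R₂ ⊆ C) {u v : V}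
    (hu : u ∈ R₁) (huC : u ∉ C) (hv : v ∈ R₂) (hvC : v ∉ C) : |a - b| ≤ ε := by
  classical
  have : Nonempty V := ⟨u⟩
  obtain ⟨E₁, hE₁⟩ := exists_honest_execution A (fun _ => a) F₁
  obtain ⟨E₂, hE₂⟩ := exists_honest_execution A (fun _ => b) F₂
  obtain ⟨t₁, ht₁⟩ := hA.outputs_const ha hF₁ (hR₁.2 u hu) E₁
  obtain ⟨t₂, ht₂⟩ := hA.outputs_const hb hF₂ (hR₂.2 v hv) E₂
  let y : V → ℝ := fun w => if w ∈ R₁ then a else b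
  obtain ⟨d₁, h1, h2, h3⟩ := exists_leads_mimics (C := C) (y := y) hR₁
    (fun w hw _ => by simp [y, hw]) E₁ hE₁ .init (fun _ _ _ => rfl) t₁
  have hdisj : ∀ w ∈ R₂, w ∉ C → w ∉ R₁ := fun w hw hwC hw' => hwC (hRC ⟨hw', hw⟩)
  obtain ⟨d₂, h4, h5, h6⟩ := exists_leads_mimics (C := C) (y := y) hR₂
    (fun w hw hwC => by simp [y, hdisj w hw hwC]) E₂ hE₂ d₁
    (fun w hw hwC => by rw [h3 w (hdisj w hw hwC)]; rfl) t₂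
  obtain ⟨E, T, hT⟩ := Leads.exists_execution (h1.trans h4)
  have huR₂ : u ∉ R₂ := fun h => huC (hRC ⟨hu, h⟩)
  refine hA.agreement y C (fun w => ?_) hC E u v a b huC hvC ⟨T, ?_⟩ ⟨T, ?_⟩
  · by_cases hw : w ∈ R₁ <;> simp [y, hw, ha, hb]
  · rw [hT, h6 u huR₂, h2.hist u hu huC]
    simpa [y, hu] using ht₁
  · rw [hT, h5.hist v hv hvC]
    simpa [y, hdisj v hv hvC] using ht₂

theorem mem_reachSet_self {F : Finset V} {u : V} (hu : u ∉ F) : u ∈ reachSet G F u :=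
  ⟨hu, .refl⟩

theorem AchievesConsensus.twoReach [Fintype V] {A : Algorithm G D} {f : ℕ}
    (hn : f < Fintype.card V) {I : Set ℝ} {ε : ℝ} (hA : AchievesConsensus A f I ε) {a b : ℝ}
    (ha : a ∈ I) (hb : b ∈ I) (hε : ε < |a - b|) : TwoReach G f (f + 1) := by
  classical
  -- A reach set of at most `f` nodes could itself be removed: the reach set of any remaining node
  -- would be disjoint from it, a contradiction already without faulty nodes.
  have key : ∀ F : Finset V, F.card ≤ f → ∀ u, u ∉ F → f < (reachSet G F u).ncard := by
    intro F hF u hu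
    by_contra! hlt
    obtain ⟨C, hC⟩ := (Set.toFinite (reachSet G F u)).exists_finset_coe
    rw [← hC, Set.ncard_coe_finset] at hlt
    obtain ⟨v, hv⟩ : ∃ v, v ∉ C := by
      by_contra! h
      rw [Finset.eq_univ_of_forall h, Finset.card_univ] at hlt
      omega
    refine hε.not_ge (hA.le_of_closedUpTo ha hb (closedUpTo_reachSet G F u)
      (closedUpTo_reachSet G C v) hF hlt (C := ∅) (by simp) ?_ (mem_reachSet_self hu) (by simp)
      (mem_reachSet_self hv) (by simp))
    rintro w ⟨hw, hw'⟩
    rw [← hC] at hw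
    exact (hw'.1 hw).elim
  intro F₁ F₂ hF₁ hF₂ u v hu hv
  by_contra! hlt
  obtain ⟨C, hC⟩ := (Set.toFinite (reachSet G F₁ u ∩ reachSet G F₂ v)).exists_finset_coe
  have hcard : C.card ≤ f := by
    rw [← Set.ncard_coe_finset, hC]
    omega
  -- The nodes `u` and `v` may lie in `C`; by `key`, each reach set still has a node outside `C`,
  -- and that node serves in their place.
  have hex : ∀ F : Finset V, F.card ≤ f → ∀ w, w ∉ F → ∃ w' ∈ reachSet G F w, w' ∉ C := by
    intro F hF w hw
    by_contra! h
    have h1 := Set.ncard_le_ncard (t := (C : Set V)) h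
    rw [Set.ncard_coe_finset] at h1
    have := key F hF w hw
    omega
  obtain ⟨u', hu', huC⟩ := hex F₁ hF₁ u hu
  obtain ⟨v', hv', hvC⟩ := hex F₂ hF₂ v hv
  exact hε.not_ge (hA.le_of_closedUpTo ha hb (closedUpTo_reachSet G F₁ u)
    (closedUpTo_reachSet G F₂ v) hF₁ hF₂ hcard hC.ge hu' huC hv' hvC)

end Necessity

/-! ## The algorithm -/

section Sufficiency

variable {V : Type*} {G : Digraph V}

/-- The signed statement of `w` that its value in round `r` is `y`. -/
def claim (w : V) (r : ℕ) (y : ℝ) : Msg V (ℕ × ℝ) := .sign w (.data (r, y))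

/-- `y` is an admissible new value after round `r`, if the values `c` of the nodes of `S` are known.
In the first round, `y` has more than `f` values on either side; later it is the midpoint of the
extreme values. -/
def IsUpdate (f : ℕ) : ℕ → Set V → (V → ℝ) → ℝ → Prop
  | 0, S, c, y => f < {s ∈ S | c s ≤ y}.ncard ∧ f < {s ∈ S | y ≤ c s}.ncard
  | _ + 1, S, c, y =>
    ∃ p ∈ S, ∃ q ∈ S, (∀ s ∈ S, c p ≤ c s ∧ c s ≤ c q) ∧ y = (c p + c q) / 2

/-- `y` is an admissible new value of `w` after round `r`, if `P` holds for the known values of the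
round. -/
def Justified (G : Digraph V) (f : ℕ) (P : V → ℝ → Prop) (r : ℕ) (w : V) (y : ℝ) : Prop :=
  ∃ F : Finset V, F.card ≤ f ∧ w ∉ F ∧ ∃ c : V → ℝ,
    (∀ s ∈ reachSet G F w, P s (c s)) ∧ IsUpdate f r (reachSet G F w) c y

/-- The messages in `K` prove that `y` is an admissible value of `w` in round `r`. -/
def Accepted (G : Digraph V) (f : ℕ) (K : Set (Msg V (ℕ × ℝ))) : ℕ → V → ℝ → Prop
  | 0, w, y => claim w 0 y ∈ K
  | r + 1, w, y => claim w (r + 1) y ∈ K ∧ Justified G f (Accepted G f K r) r w y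

theorem Justified.mono {f : ℕ} {P P' : V → ℝ → Prop} (h : ∀ s z, P s z → P' s z) {r : ℕ} {w : V}
    {y : ℝ} (hj : Justified G f P r w y) : Justified G f P' r w y := by
  obtain ⟨F, hF, hw, c, hc, hy⟩ := hj
  exact ⟨F, hF, hw, c, fun s hs => h _ _ (hc s hs), hy⟩

theorem Accepted.mono {f : ℕ} {K K' : Set (Msg V (ℕ × ℝ))} (hK : K ⊆ K') {r : ℕ} {w : V} {y : ℝ}
    (h : Accepted G f K r w y) : Accepted G f K' r w y := by
  induction r generalizing w y with
  | zero => exact hK h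
  | succ r ih => exact ⟨hK h.1, h.2.mono fun _ _ => ih⟩

theorem Accepted.claim_mem {f : ℕ} {K : Set (Msg V (ℕ × ℝ))} {r : ℕ} {w : V} {y : ℝ}
    (h : Accepted G f K r w y) : claim w r y ∈ K := by
  cases r with
  | zero => exact h
  | succ r => exact h.1

/-- The messages known to `v`, if `L` is the list of its values in the past rounds. -/
def knownList (v : V) (L : List ℝ) (h : History V (ℕ × ℝ)) : List (Msg V (ℕ × ℝ)) :=
  h.reduceOption.map Prod.snd ++ L.zipIdx.map fun p => claim v p.2 p.1

/-- The set of the messages known to `v`, if `L` is the list of its values in the past rounds. -/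
def known (v : V) (L : List ℝ) (h : History V (ℕ × ℝ)) : Set (Msg V (ℕ × ℝ)) :=
  {m | m ∈ knownList v L h}

theorem mem_known {v : V} {L : List ℝ} {h : History V (ℕ × ℝ)} {m : Msg V (ℕ × ℝ)} :
    m ∈ known v L h ↔ m ∈ received h ∨ ∃ r y, L[r]? = some y ∧ m = claim v r y := by
  simp only [known, knownList, received, Set.mem_ofPred_eq, List.mem_append, List.mem_map,
    List.reduceOption_mem_iff, Prod.exists, List.mem_zipIdx_iff_getElem?]
  constructor
  · rintro (⟨u, m', h, rfl⟩ | ⟨y, r, h, rfl⟩)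
    · exact .inl ⟨u, h⟩
    · exact .inr ⟨r, y, h, rfl⟩
  · rintro (⟨u, h⟩ | ⟨r, y, h, rfl⟩)
    · exact .inl ⟨u, m, h, rfl⟩
    · exact .inr ⟨y, r, h, rfl⟩

theorem getElem?_of_prefix {α : Type*} {L L' : List α} (h : L <+: L') {r : ℕ} {y : α}
    (hy : L[r]? = some y) : L'[r]? = some y := by
  obtain ⟨l, rfl⟩ := h
  rw [List.getElem?_append_left (List.getElem?_eq_some_iff.1 hy).1, hy]

theorem known_mono {v : V} {L L' : List ℝ} (hL : L <+: L') {h h' : History V (ℕ × ℝ)}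
    (hh : received h ⊆ received h') : known v L h ⊆ known v L' h' := by
  intro m hm
  rw [mem_known] at hm ⊢
  rcases hm with hm | ⟨r, y, hy, rfl⟩
  · exact .inl (hh hm)
  · exact .inr ⟨r, y, getElem?_of_prefix hL hy, rfl⟩

theorem received_subset_cons (h : History V (ℕ × ℝ)) (e : Option (V × Msg V (ℕ × ℝ))) :
    received h ⊆ received (e :: h) :=
  fun _ ⟨u, hu⟩ => ⟨u, List.mem_cons_of_mem _ hu⟩

open Classical in
/-- The values of the node `v` in the rounds that it has completed. -/
noncomputable def values (G : Digraph V) (f : ℕ) (v : V) (x : ℝ) : History V (ℕ × ℝ) → List ℝ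
  | [] => [x]
  | e :: h =>
    if hy : ∃ y, Justified G f (Accepted G f (known v (values G f v x h) (e :: h))
        ((values G f v x h).length - 1)) ((values G f v x h).length - 1) v y then
      values G f v x h ++ [hy.choose]
    else values G f v x h

theorem values_prefix_cons (G : Digraph V) (f : ℕ) (v : V) (x : ℝ) (h : History V (ℕ × ℝ))
    (e : Option (V × Msg V (ℕ × ℝ))) : values G f v x h <+: values G f v x (e :: h) := by
  rw [values]
  split_ifs
  · exact List.prefix_append _ _
  · exact List.prefix_rfl

theorem values_zero (G : Digraph V) (f : ℕ) (v : V) (x : ℝ) (h : History V (ℕ × ℝ)) :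
    (values G f v x h)[0]? = some x := by
  induction h with
  | nil => rfl
  | cons e h ih => exact getElem?_of_prefix (values_prefix_cons G f v x h e) ih

/-- A node keeps knowing the claims that justified its values. Whoever learns all it knows therefore
accepts its values too, by `Accepted.mono`, without proofs being packed into messages. -/
theorem accepted_values {f : ℕ} {v : V} {x : ℝ} {h : History V (ℕ × ℝ)} {r : ℕ} {y : ℝ}
    (hy : (values G f v x h)[r]? = some y) :
    Accepted G f (known v (values G f v x h) h) r v y := by
  induction h generalizing r y with
  | nil =>
    have hy' := hy
    obtain ⟨hr, -⟩ := List.getElem?_eq_some_iff.1 hy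
    simp only [values, List.length_singleton, Nat.lt_one_iff] at hr
    subst hr
    exact mem_known.2 (.inr ⟨0, y, hy, rfl⟩)
  | cons e h ih =>
    have hmono : known v (values G f v x h) (e :: h) ⊆
        known v (values G f v x (e :: h)) (e :: h) :=
      known_mono (values_prefix_cons G f v x h e) subset_rfl
    have hmono' : known v (values G f v x h) h ⊆ known v (values G f v x h) (e :: h) :=
      known_mono List.prefix_rfl (received_subset_cons h e)
    by_cases hr : r < (values G f v x h).length
    · refine (ih ?_).mono (hmono'.trans hmono)
      have h1 := getElem?_of_prefix (values_prefix_cons G f v x h e)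
        (List.getElem?_eq_getElem hr)
      rw [List.getElem?_eq_getElem hr, ← h1, hy]
    -- The list is never empty, so the `length - 1` in `values` is a genuine predecessor: the index
    -- of the last completed round.
    · have hpos : 0 < (values G f v x h).length :=
        (List.getElem?_eq_some_iff.1 (values_zero G f v x h)).1
      have hmem : claim v r y ∈ known v (values G f v x (e :: h)) (e :: h) :=
        mem_known.2 (.inr ⟨r, y, hy, rfl⟩)
      rw [values] at hy
      split_ifs at hy with hj
      · have hr' : r = (values G f v x h).length := by
          have := (List.getElem?_eq_some_iff.1 hy).1
          simp only [List.length_append, List.length_singleton] at this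
          omega
        rw [hr', List.getElem?_concat_length, Option.some.injEq] at hy
        have hj' := hj.choose_spec
        rw [hy] at hj'
        obtain ⟨k, rfl⟩ : ∃ k, r = k + 1 := ⟨r - 1, by omega⟩
        rw [← hr', Nat.add_sub_cancel] at hj'
        exact ⟨hmem, hj'.mono fun _ _ h' => h'.mono hmono⟩
      · exact absurd (List.getElem?_eq_some_iff.1 hy).1 hr

open Classical in
/-- In every step, each node sends everything it knows to all outgoing neighbours. Its output is
its value in round `N`. -/
noncomputable def floodAlgorithm [Fintype V] (G : Digraph V) (f N : ℕ) :
    Algorithm G (ℕ × ℝ) where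
  send v x h := (Finset.univ.filter (G.Adj v)).toList.flatMap fun w =>
    (knownList v (values G f v x h) h).map fun m => (w, m)
  output v x h := (values G f v x h)[N]?
  send_adj := by
    intro v x h p hp
    simp only [List.mem_flatMap, Finset.mem_toList, Finset.mem_filter, List.mem_map] at hp
    obtain ⟨w, ⟨-, hw⟩, m, -, rfl⟩ := hp
    exact hw
  send_derivable := by
    intro v x h p hp
    simp only [List.mem_flatMap, List.mem_map] at hp
    obtain ⟨w, -, m, hm, rfl⟩ := hp
    rcases mem_known.1 hm with hm | ⟨r, y, -, rfl⟩
    · exact .known hm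
    · exact .sign rfl (.data _)
  output_stable := fun v x h e _ hy => getElem?_of_prefix (values_prefix_cons G f v x h e) hy

theorem mem_floodAlgorithm_send [Fintype V] {f N : ℕ} {v : V} {x : ℝ} {h : History V (ℕ × ℝ)}
    {p : V × Msg V (ℕ × ℝ)} :
    p ∈ (floodAlgorithm G f N).send v x h ↔ G.Adj v p.1 ∧ p.2 ∈ known v (values G f v x h) h := by
  classical
  obtain ⟨w, m⟩ := p
  simp [floodAlgorithm, known]

/-! ## Existence of updates -/

/-- Removing `f` nodes of the reach set as a second fault set leaves at least `f + 1` nodes in the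
intersection, all different from the removed ones. -/
theorem TwoReach.two_mul_lt_ncard [Fintype V] {f : ℕ} (hG : TwoReach G f (f + 1))
    (hn : f < Fintype.card V) {F : Finset V} (hF : F.card ≤ f) {u : V} (hu : u ∉ F) :
    2 * f < (reachSet G F u).ncard := by
  classical
  have h1 := hG F F hF hF u u hu hu
  rw [Set.inter_self] at h1
  obtain ⟨T, hT, hTc⟩ := Set.exists_subset_card_eq (show f ≤ (reachSet G F u).ncard by omega)
  obtain ⟨F', rfl⟩ := (Set.toFinite T).exists_finset_coe
  rw [Set.ncard_coe_finset] at hTc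
  obtain ⟨v, hv⟩ : ∃ v, v ∉ F' := by
    by_contra! h
    rw [Finset.eq_univ_of_forall h, Finset.card_univ] at hTc
    omega
  have h2 := hG F F' hF hTc.le u v hu hv
  have h3 : Disjoint (reachSet G F u ∩ reachSet G F' v) (F' : Set V) :=
    Set.disjoint_left.2 fun w hw hw' => hw.2.1 hw'
  have h4 := Set.ncard_union_eq h3
  rw [Set.ncard_coe_finset] at h4
  have h5 : ((reachSet G F u ∩ reachSet G F' v) ∪ (F' : Set V)).ncard ≤ (reachSet G F u).ncard :=
    Set.ncard_le_ncard (Set.union_subset Set.inter_subset_left hT)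
  omega

/-- For round `0`, take the least value with more than `f` values at or below it. By minimality at
most `f` values are strictly below, so more than `f` of the over `2f` values are at or above. -/
theorem exists_isUpdate [Finite V] {f : ℕ} (r : ℕ) {S : Set V} (hS : 2 * f < S.ncard)
    (c : V → ℝ) : ∃ y, IsUpdate f r S c y := by
  have hne : S.Nonempty := by
    rw [← Set.ncard_pos]
    omega
  obtain ⟨q, hq, hmax⟩ := Set.exists_max_image S c (Set.toFinite S) hne
  cases r with
  | succ r =>
    obtain ⟨p, hp, hmin⟩ := Set.exists_min_image S c (Set.toFinite S) hne
    exact ⟨_, p, hp, q, hq, fun s hs => ⟨hmin s hs, hmax s hs⟩, rfl⟩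
  | zero =>
    let T : Set V := {t ∈ S | f < {s ∈ S | c s ≤ c t}.ncard}
    have hT : T.Nonempty := by
      refine ⟨q, hq, ?_⟩
      have : {s ∈ S | c s ≤ c q} = S := Set.sep_eq_self_iff_mem_true.2 hmax
      rw [this]
      omega
    obtain ⟨p, ⟨hp, hpf⟩, hmin⟩ := Set.exists_min_image T c (Set.toFinite T) hT
    refine ⟨c p, hpf, ?_⟩
    have hlt : {s ∈ S | c s < c p}.ncard ≤ f := by
      by_contra! hlt
      have hne' : {s ∈ S | c s < c p}.Nonempty := by
        rw [← Set.ncard_pos]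
        omega
      obtain ⟨z, hz, hzmax⟩ := Set.exists_max_image _ c (Set.toFinite _) hne'
      refine (hmin z ⟨hz.1, hlt.trans_le (Set.ncard_le_ncard ?_)⟩).not_gt hz.2
      exact fun s hs => ⟨hs.1, hzmax s hs⟩
    have hU : S ⊆ {s ∈ S | c s < c p} ∪ {s ∈ S | c p ≤ c s} := by
      intro s hs
      rcases lt_or_ge (c s) (c p) with h | h
      · exact .inl ⟨hs, h⟩
      · exact .inr ⟨hs, h⟩
    have h1 := Set.ncard_le_ncard hU
    have h2 := Set.ncard_union_le {s ∈ S | c s < c p} {s ∈ S | c p ≤ c s}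
    omega

/-! ## Executions: monotonicity and flooding -/

section Run

variable {D : Type*} {A : Algorithm G D} {x : V → ℝ} {F : Finset V}

theorem Step.hist_eq {e : Event V D} {c c' : Config V D} (h : Step A x F e c c') (v : V) :
    c'.hist v = c.hist v ∨ ∃ o, c'.hist v = o :: c.hist v := by
  classical
  cases h with
  | internal _ w =>
    by_cases hw : v = w
    · subst hw
      exact .inr ⟨none, by simp [Config.advance]⟩
    · exact .inl (by simp [Config.advance, Function.update_of_ne hw])
  | deliver _ u w m rest h =>
    by_cases hw : v = w
    · subst hw
      exact .inr ⟨some (u, m), by simp [Config.advance]⟩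
    · exact .inl (by simp [Config.advance, Function.update_of_ne hw])
  | inject => exact .inl rfl

theorem Step.send_mem_net {e : Event V D} {c c' : Config V D} (h : Step A x F e c c') {v : V}
    (hv : v ∉ F) (he : e.actor = some v) {p : V × Msg V D}
    (hp : p ∈ A.send v (x v) (c'.hist v)) : (v, p.1, p.2) ∈ c'.net := by
  classical
  cases h with
  | internal _ w =>
    obtain rfl : w = v := by simpa [Event.actor] using he
    refine Multiset.mem_add.2 (.inr ?_)
    rw [if_neg hv]
    refine List.mem_map.2 ⟨p, ?_, rfl⟩
    simpa [Config.advance] using hp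
  | deliver _ u w m rest h =>
    obtain rfl : w = v := by simpa [Event.actor] using he
    refine Multiset.mem_add.2 (.inr ?_)
    rw [if_neg hv]
    refine List.mem_map.2 ⟨p, ?_, rfl⟩
    simpa [Config.advance] using hp
  | inject => simp [Event.actor] at he

theorem Step.mem_received {u v : V} {m : Msg V D} {c c' : Config V D}
    (h : Step A x F (.deliver u v m) c c') : m ∈ received (c'.hist v) := by
  classical
  cases h with
  | deliver _ _ _ _ rest h => exact ⟨u, by simp [Config.advance]⟩

theorem Step.exists_hist_cons {e : Event V D} {c c' : Config V D} (h : Step A x F e c c') {v : V}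
    (he : e.actor = some v) : ∃ o, c'.hist v = o :: c.hist v := by
  classical
  cases h with
  | internal _ w =>
    obtain rfl : w = v := by simpa [Event.actor] using he
    exact ⟨none, by simp [Config.advance]⟩
  | deliver _ u w m rest h =>
    obtain rfl : w = v := by simpa [Event.actor] using he
    exact ⟨some (u, m), by simp [Config.advance]⟩
  | inject => simp [Event.actor] at he

/-- `m` contains the signature of `w` on `b`. -/
def HasSig (w : V) (b : Msg V D) : Msg V D → Prop
  | .data _ => False
  | .pair m₁ m₂ => HasSig w b m₁ ∨ HasSig w b m₂
  | .sign u m => (u = w ∧ m = b) ∨ HasSig w b m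

/-- Only the rule `sign` creates a signature, and it needs a key in `C`; every other rule merely
copies, combines or extracts. -/
theorem Derivable.exists_hasSig {C : Set V} {K : Set (Msg V D)} {m : Msg V D}
    (h : Derivable C K m) {w : V} (hw : w ∉ C) {b : Msg V D} (hb : HasSig w b m) :
    ∃ m' ∈ K, HasSig w b m' := by
  induction h with
  | known h => exact ⟨_, h, hb⟩
  | data d => exact hb.elim
  | pair _ _ h₁ h₂ => exact hb.elim h₁ h₂
  | fst _ h => exact h (.inl hb)
  | snd _ h => exact h (.inr hb)
  | sign hu _ h =>
    rcases hb with ⟨rfl, -⟩ | hb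
    · exact (hw hu).elim
    · exact h hb
  | content _ h => exact h (.inr hb)

end Run

theorem Step.values_prefix {f : ℕ} {x : V → ℝ} {F : Finset V} {A : Algorithm G (ℕ × ℝ)} {e : Event V (ℕ × ℝ)}
    {c c' : Config V (ℕ × ℝ)} (h : Step A x F e c c') (v : V) :
    values G f v (x v) (c.hist v) <+: values G f v (x v) (c'.hist v) := by
  rcases h.hist_eq v with h | ⟨o, h⟩
  · rw [h]
  · rw [h]
    exact values_prefix_cons _ _ _ _ _ _

/-! ### Progress of the flooding algorithm. -/

section Flood

variable [Fintype V] {f N : ℕ} {x : V → ℝ} {F : Finset V}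

variable (E : Execution (floodAlgorithm G f N) x F)

/-- The values of `v` at time `t`. -/
noncomputable def Execution.values (v : V) (t : ℕ) : List ℝ :=
  _root_.values G f v (x v) ((E.config t).hist v)

/-- The messages known to `v` at time `t`. -/
noncomputable def Execution.known (v : V) (t : ℕ) : Set (Msg V (ℕ × ℝ)) :=
  _root_.known v (E.values v t) ((E.config t).hist v)

theorem Execution.values_prefix (v : V) {t t' : ℕ} (h : t ≤ t') :
    E.values v t <+: E.values v t' := by
  induction h with
  | refl => exact List.prefix_rfl
  | step _ ih => exact ih.trans ((E.step _).values_prefix v)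

theorem Execution.known_mono (v : V) {t t' : ℕ} (h : t ≤ t') : E.known v t ⊆ E.known v t' := by
  induction h with
  | refl => exact subset_rfl
  | step _ ih =>
    refine ih.trans (_root_.known_mono ((E.step _).values_prefix v) ?_)
    rcases (E.step _).hist_eq v with h | ⟨o, h⟩
    · rw [h]
    · rw [h]
      exact received_subset_cons _ _

theorem Execution.accepted_values {v : V} {t r : ℕ} {y : ℝ} (h : (E.values v t)[r]? = some y) :
    Accepted G f (E.known v t) r v y :=
  _root_.accepted_values h

theorem Execution.exists_mem_known_of_adj {v w : V} (hv : v ∉ F) (hw : w ∉ F) (hvw : G.Adj v w)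
    {m : Msg V (ℕ × ℝ)} {t : ℕ} (hm : m ∈ E.known v t) : ∃ t', m ∈ E.known w t' := by
  obtain ⟨t₁, ht₁, he⟩ := E.live v hv t
  have hm₁ : m ∈ E.known v (t₁ + 1) := E.known_mono v (by omega) hm
  have hnet := (E.step t₁).send_mem_net hv he (p := (w, m))
    (mem_floodAlgorithm_send.2 ⟨hvw, hm₁⟩)
  obtain ⟨t₂, -, he₂⟩ := E.reliable v w m hw _ hnet
  have hs := E.step t₂
  rw [he₂] at hs
  exact ⟨t₂ + 1, mem_known.2 (.inl hs.mem_received)⟩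

theorem Execution.exists_mem_known {s w : V} (h : s ∈ reachSet G F w)
    {m : Msg V (ℕ × ℝ)} {t : ℕ} (hm : m ∈ E.known s t) : ∃ t', m ∈ E.known w t' := by
  have h2 := h.2
  induction h2 using Relation.ReflTransGen.head_induction_on generalizing t with
  | refl => exact ⟨t, hm⟩
  | head h' h'' ih =>
    obtain ⟨t₁, ht₁⟩ := E.exists_mem_known_of_adj h'.2.1 h'.2.2 h'.1 hm
    exact ih ⟨h'.2.2, h''⟩ ht₁

/-- Only finitely many messages are known at a given time, so one moment serves for all of them. -/
theorem Execution.eventually_known_subset {s w : V} (h : s ∈ reachSet G F w) (t : ℕ) :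
    ∀ᶠ t' in Filter.atTop, E.known s t ⊆ E.known w t' := by
  have hfin : (E.known s t).Finite := List.finite_toSet _
  refine (hfin.eventually_all.2 fun m hm => ?_ : ∀ᶠ t' in Filter.atTop, ∀ m ∈ E.known s t,
    m ∈ E.known w t')
  obtain ⟨t₁, ht₁⟩ := E.exists_mem_known h hm
  exact Filter.eventually_atTop.2 ⟨t₁, fun t' ht' => E.known_mono w ht' ht₁⟩

theorem Execution.exists_value (hG : TwoReach G f (f + 1)) (hn : f < Fintype.card V)
    (hF : F.card ≤ f) (r : ℕ) {w : V} (hw : w ∉ F) : ∃ t y, (E.values w t)[r]? = some y := by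
  induction r generalizing w with
  | zero => exact ⟨0, _, values_zero _ _ _ _ _⟩
  | succ r ih =>
    -- Faulty nodes get dummy values, never used because `reachSet G F w` avoids `F`.
    have ih' : ∀ s, ∃ t y, s ∉ F → (E.values s t)[r]? = some y := by
      intro s
      by_cases hs : s ∈ F
      · exact ⟨0, 0, fun h => (h hs).elim⟩
      · obtain ⟨t, y, h⟩ := ih hs
        exact ⟨t, y, fun _ => h⟩
    choose t c hc using ih'
    have hev : ∀ᶠ t' in Filter.atTop, ∀ s ∈ reachSet G F w,
        Accepted G f (E.known w t') r s (c s) := by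
      refine (Set.toFinite _).eventually_all.2 fun s hs => ?_
      filter_upwards [E.eventually_known_subset hs (t s)] with t' ht'
      exact (E.accepted_values (hc s hs.1)).mono ht'
    obtain ⟨T₀, hT₀⟩ := Filter.eventually_atTop.1 hev
    obtain ⟨T, hT, he⟩ := E.live w hw (max T₀ (t w))
    by_contra! hno
    have hlen : (E.values w T).length = r + 1 := by
      have h1 := (List.getElem?_eq_some_iff.1
        (getElem?_of_prefix (E.values_prefix w ((le_max_right _ _).trans hT)) (hc w hw))).1
      by_contra hne
      exact hno T _ (List.getElem?_eq_getElem (show r + 1 < (E.values w T).length by omega))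
    obtain ⟨y, hy⟩ := exists_isUpdate r (hG.two_mul_lt_ncard hn hF hw) c
    -- The true faulty set is a witness. The node need not know it: it tests only for existence and
    -- may adopt a value justified by another set.
    have hj : Justified G f (Accepted G f (E.known w T) r) r w y :=
      ⟨F, hF, hw, c, hT₀ T ((le_max_left _ _).trans hT), hy⟩
    obtain ⟨o, ho⟩ := (E.step T).exists_hist_cons he
    have hex : ∃ y, Justified G f (Accepted G f (_root_.known w (E.values w T)
        (o :: (E.config T).hist w)) ((E.values w T).length - 1)) ((E.values w T).length - 1)
        w y := by
      rw [hlen, Nat.add_sub_cancel]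
      exact ⟨y, hj.mono fun _ _ h =>
        h.mono (_root_.known_mono List.prefix_rfl (received_subset_cons _ _))⟩
    refine hno (T + 1) hex.choose ?_
    have hval : E.values w (T + 1) = E.values w T ++ [hex.choose] := by
      unfold Execution.values
      rw [ho, _root_.values]
      exact dif_pos hex
    rw [hval, ← hlen, List.getElem?_concat_length]

/-! ## Unforgeability -/

/-- All signatures of non-faulty nodes in `m` are on statements about their actual values at
time `t`. -/
def Execution.Genuine (t : ℕ) (m : Msg V (ℕ × ℝ)) : Prop :=
  ∀ w ∉ F, ∀ b, HasSig w b m → ∃ r y, (E.values w t)[r]? = some y ∧ b = .data (r, y)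

theorem Execution.Genuine.mono {t t' : ℕ} (h : t ≤ t') {m : Msg V (ℕ × ℝ)}
    (hm : E.Genuine t m) : E.Genuine t' m := by
  intro w hw b hb
  obtain ⟨r, y, hy, rfl⟩ := hm w hw b hb
  exact ⟨r, y, getElem?_of_prefix (E.values_prefix w h) hy, rfl⟩

theorem Execution.genuine_claim {v : V} {t r : ℕ} {y : ℝ} (h : (E.values v t)[r]? = some y) :
    E.Genuine t (claim v r y) := by
  rintro w - b (⟨rfl, rfl⟩ | hb)
  · exact ⟨r, y, h, rfl⟩
  · exact hb.elim

theorem Execution.Genuine.value {t : ℕ} {w : V} (hw : w ∉ F) {r : ℕ} {y : ℝ}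
    (h : E.Genuine t (claim w r y)) : (E.values w t)[r]? = some y := by
  obtain ⟨r', y', h', heq⟩ := h w hw _ (.inl ⟨rfl, rfl⟩)
  simp only [Msg.data.injEq, Prod.mk.injEq] at heq
  obtain ⟨rfl, rfl⟩ := heq
  exact h'

theorem Execution.genuine_known_of_received {t : ℕ}
    (h : ∀ v, ∀ m ∈ received ((E.config t).hist v), E.Genuine t m) (v : V) :
    ∀ m ∈ E.known v t, E.Genuine t m := by
  intro m hm
  rcases mem_known.1 hm with hm | ⟨r, y, hy, rfl⟩
  · exact h v m hm
  · exact E.genuine_claim hy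

/-- Messages in transit and received messages are controlled together, by induction on time. Honest
nodes forward genuine messages or sign their own values; for Byzantine messages,
`Derivable.exists_hasSig` traces each honest signature back to a received message. -/
theorem Execution.genuine (t : ℕ) : (∀ p ∈ (E.config t).net, E.Genuine t p.2.2) ∧
    ∀ v, ∀ m ∈ received ((E.config t).hist v), E.Genuine t m := by
  classical
  induction t with
  | zero =>
    refine ⟨by simp [E.net_zero], fun v m hm => ?_⟩
    rw [E.hist_zero] at hm
    obtain ⟨u, hu⟩ := hm
    simp at hu
  | succ t ih =>
    have hadv : ∀ (c : Config V (ℕ × ℝ)) (v : V) (o : Option (V × Msg V (ℕ × ℝ))),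
        c.hist = (E.config t).hist → (∀ p ∈ c.net, E.Genuine t p.2.2) →
        (∀ u m, o = some (u, m) → E.Genuine t m) →
        E.config (t + 1) = c.advance (floodAlgorithm G f N) x F v o →
        (∀ p ∈ (E.config (t + 1)).net, E.Genuine (t + 1) p.2.2) ∧
        ∀ v, ∀ m ∈ received ((E.config (t + 1)).hist v), E.Genuine (t + 1) m := by
      intro c v o hc hnet ho heq
      have hrec : ∀ v, ∀ m ∈ received ((E.config (t + 1)).hist v), E.Genuine (t + 1) m := by
        intro w m hm
        refine Execution.Genuine.mono E (Nat.le_succ t) ?_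
        rw [heq] at hm
        by_cases hw : w = v
        · subst hw
          simp only [Config.advance, Function.update_self, hc] at hm
          obtain ⟨u, hu⟩ := hm
          rcases List.mem_cons.1 hu with hu | hu
          · exact ho u m hu.symm
          · exact ih.2 w m ⟨u, hu⟩
        · simp only [Config.advance, Function.update_of_ne hw, hc] at hm
          exact ih.2 w m hm
      refine ⟨fun p hp => ?_, hrec⟩
      -- The sender may have just adopted a new value, so what it sends is genuine at time `t + 1`
      -- and not necessarily at time `t`.
      have hk := E.genuine_known_of_received hrec v
      unfold Execution.known Execution.values at hk
      rw [heq] at hp hk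
      rcases Multiset.mem_add.1 hp with hp | hp
      · exact Execution.Genuine.mono E (Nat.le_succ t) (hnet p hp)
      · split_ifs at hp
        · simp at hp
        · obtain ⟨p', hp', rfl⟩ := List.mem_map.1 (Multiset.mem_coe.1 hp)
          apply hk
          have := (mem_floodAlgorithm_send.1 hp').2
          simpa [Config.advance] using this
    have hs := E.step t
    generalize hev : E.event t = ev at hs
    generalize hc' : E.config (t + 1) = c' at hs
    rw [← hc']
    cases hs with
    | internal _ v =>
      exact hadv (E.config t) v none rfl ih.1 (by simp) hc'
    | deliver _ u v m rest h =>
      refine hadv ⟨(E.config t).hist, rest⟩ v (some (u, m)) rfl ?_ ?_ hc'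
      · exact fun p hp => ih.1 p (by rw [h]; exact Multiset.mem_cons_of_mem hp)
      · intro u' m' h'
        simp only [Option.some.injEq, Prod.mk.injEq] at h'
        obtain ⟨rfl, rfl⟩ := h'
        exact ih.1 (u, v, m) (by rw [h]; exact Multiset.mem_cons_self _ _)
    | inject _ b v m hb hbv hm =>
      rw [hc']
      refine ⟨fun p hp => Execution.Genuine.mono E (Nat.le_succ t) ?_,
        fun v m hm => Execution.Genuine.mono E (Nat.le_succ t) (ih.2 v m hm)⟩
      rcases Multiset.mem_cons.1 hp with rfl | hp
      · intro w hw b' hb'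
        obtain ⟨m', ⟨b'', -, hm'⟩, hsig⟩ := hm.exists_hasSig (by simpa using hw) hb'
        exact ih.2 b'' m' hm' w hw b' hsig
      · exact ih.1 p hp

/-! ## Validity and convergence -/

/-- The messages that are genuine at some time. -/
def Execution.genuineSet : Set (Msg V (ℕ × ℝ)) := {m | ∃ t, E.Genuine t m}

/-- Acceptance relative to `genuineSet` depends on neither observer nor time, so values certified at
different nodes and moments become comparable. -/
theorem Execution.accepted_genuineSet {v : V} {t r : ℕ} {y : ℝ}
    (h : (E.values v t)[r]? = some y) : Accepted G f E.genuineSet r v y :=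
  (E.accepted_values h).mono fun m hm =>
    show ∃ t, E.Genuine t m from ⟨t, E.genuine_known_of_received (E.genuine t).2 v m hm⟩

theorem Execution.accepted_unique {w : V} (hw : w ∉ F) {r : ℕ} {y z : ℝ}
    (hy : Accepted G f E.genuineSet r w y) (hz : Accepted G f E.genuineSet r w z) : y = z := by
  obtain ⟨t, ht⟩ := hy.claim_mem
  obtain ⟨t', ht'⟩ := hz.claim_mem
  have h1 := Execution.Genuine.value E hw (Execution.Genuine.mono E (le_max_left t t') ht)
  have h2 := Execution.Genuine.value E hw (Execution.Genuine.mono E (le_max_right t t') ht')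
  rw [h1] at h2
  exact Option.some.inj h2

theorem Execution.accepted_zero {w : V} (hw : w ∉ F) {y : ℝ}
    (hy : Accepted G f E.genuineSet 0 w y) : y = x w :=
  E.accepted_unique hw hy (E.accepted_genuineSet (t := 0) (values_zero _ _ _ _ _))

theorem exists_notMem_of_card_lt_ncard {F : Finset V} {S : Set V} (h : F.card < S.ncard) :
    ∃ s ∈ S, s ∉ F := by
  by_contra! h'
  have := Set.ncard_le_ncard (t := (F : Set V)) h'
  rw [Set.ncard_coe_finset] at this
  omega

/-- The bound starts at round `1`, since a faulty node may claim any initial value. More than `f`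
values on either side of `y` include a non-faulty input on each side; later midpoints stay in the
hull. -/
theorem Execution.accepted_mem_convexHull (hF : F.card ≤ f) {r : ℕ} {w : V} {y : ℝ}
    (h : Accepted G f E.genuineSet (r + 1) w y) : y ∈ convexHull ℝ (x '' {w | w ∉ F}) := by
  induction r generalizing w y with
  | zero =>
    obtain ⟨-, F', hF', hw, c, hc, h1, h2⟩ := h
    obtain ⟨p, ⟨hp, hpy⟩, hpF⟩ := exists_notMem_of_card_lt_ncard (hF.trans_lt h1)
    obtain ⟨q, ⟨hq, hqy⟩, hqF⟩ := exists_notMem_of_card_lt_ncard (hF.trans_lt h2)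
    rw [E.accepted_zero hpF (hc p hp)] at hpy
    rw [E.accepted_zero hqF (hc q hq)] at hqy
    exact (convex_convexHull ℝ _).ordConnected.out
      (subset_convexHull ℝ _ (Set.mem_image_of_mem x hpF))
      (subset_convexHull ℝ _ (Set.mem_image_of_mem x hqF))
      (Set.mem_Icc.2 ⟨hpy, hqy⟩)
  | succ r ih =>
    obtain ⟨-, F', hF', hw, c, hc, p, hp, q, hq, hpq, rfl⟩ := h
    exact (convex_convexHull ℝ _).ordConnected.out (ih (hc p hp)) (ih (hc q hq))
      (Set.mem_Icc.2 ⟨by linarith [(hpq p hp).2], by linarith [(hpq p hp).2]⟩)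

/-- The two reach sets share a non-faulty `s`, whose value is the same in both, so `c p ≤ c s ≤ c'
q'`. In `y - z = ((c p - c' q') + (c q - c' p')) / 2` the first bracket is thus nonpositive, and the
second is bounded by induction. -/
theorem Execution.accepted_sub_le (hG : TwoReach G f (f + 1)) (hF : F.card ≤ f) {a b : ℝ}
    (hx : ∀ v, x v ∈ Set.Icc a b) {r : ℕ} {v w : V} {y z : ℝ}
    (hy : Accepted G f E.genuineSet (r + 1) v y) (hz : Accepted G f E.genuineSet (r + 1) w z) :
    y - z ≤ (b - a) / 2 ^ r := by
  induction r generalizing v w y z with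
  | zero =>
    have hsub : convexHull ℝ (x '' {w | w ∉ F}) ⊆ Set.Icc a b :=
      convexHull_min (by rintro _ ⟨w, -, rfl⟩; exact hx w) (convex_Icc a b)
    have h1 := hsub (E.accepted_mem_convexHull hF hy)
    have h2 := hsub (E.accepted_mem_convexHull hF hz)
    simp only [pow_zero, div_one]
    linarith [h1.2, h2.1]
  | succ r ih =>
    obtain ⟨-, F₁, hF₁, hv, c, hc, p, hp, q, hq, hpq, rfl⟩ := hy
    obtain ⟨-, F₂, hF₂, hw, c', hc', p', hp', q', hq', hpq', rfl⟩ := hz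
    obtain ⟨s, ⟨hs, hs'⟩, hsF⟩ := exists_notMem_of_card_lt_ncard
      (hF.trans_lt (hG F₁ F₂ hF₁ hF₂ v w hv hw))
    have hss := E.accepted_unique hsF (hc s hs) (hc' s hs')
    have h1 := ih (hc q hq) (hc' p' hp')
    have h2 := (hpq s hs).1
    have h3 := (hpq' s hs').2
    rw [pow_succ, ← div_div]
    linarith

/-- The output round is `k + 1`: one trimming round followed by `k` halvings. -/
theorem floodAlgorithm_achievesConsensus {k : ℕ} (hG : TwoReach G f (f + 1))
    (hn : f < Fintype.card V) {I : Set ℝ} {a b ε : ℝ} (hI : I ⊆ Set.Icc a b)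
    (hε : (b - a) / 2 ^ k ≤ ε) : AchievesConsensus (floodAlgorithm G f (k + 1)) f I ε where
  termination x F _ hF E v hv := by
    obtain ⟨t, y, h⟩ := E.exists_value hG hn hF (k + 1) hv
    exact ⟨y, t, h⟩
  validity x F _ hF E v y _ := by
    rintro ⟨t, ht⟩
    exact E.accepted_mem_convexHull hF (E.accepted_genuineSet ht)
  agreement x F hx hF E v w y z _ _ := by
    rintro ⟨t, ht⟩ ⟨t', ht'⟩
    have hx' : ∀ v, x v ∈ Set.Icc a b := fun v => hI (hx v)
    have hy := E.accepted_genuineSet ht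
    have hz := E.accepted_genuineSet ht'
    have h1 := E.accepted_sub_le hG hF hx' hy hz
    have h2 := E.accepted_sub_le hG hF hx' hz hy
    exact abs_le.2 ⟨by linarith, by linarith⟩

end Flood

end Sufficiency

/-! ### The equivalence. -/

theorem TwoReach.consensusPossible {V : Type*} [Fintype V] {G : Digraph V} {f : ℕ}
    (hG : TwoReach G f (f + 1)) (hn : f < Fintype.card V) {I : Set ℝ} {a b : ℝ}
    (hI : I ⊆ Set.Icc a b) {ε : ℝ} (hε : 0 < ε) : ConsensusPossible G f I ε := by
  obtain ⟨k, hk⟩ := pow_unbounded_of_one_lt ((b - a) / ε) (one_lt_two (α := ℝ))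
  refine ⟨_, floodAlgorithm G f (k + 1), floodAlgorithm_achievesConsensus hG hn hI ?_⟩
  rw [div_le_iff₀ (by positivity)]
  rw [div_lt_iff₀ hε] at hk
  linarith

theorem mainTheorem4 {V : Type*} [Fintype V] (G : Digraph V) (f : ℕ)
    (hf : 0 < f) (hn : f < Fintype.card V)
    (I : Set ℝ) (a b : ℝ) (hab : a < b) (ha : a ∈ I) (hb : b ∈ I) (hI : I ⊆ Set.Icc a b) :
    ((∀ ε : ℝ, 0 < ε → ConsensusPossible G f I ε) ↔ TwoReach G f (f + 1)) ∧
    (∀ ε : ℝ, 0 < ε → ε < b - a → (ConsensusPossible G f I ε ↔ TwoReach G f (f + 1))) := by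
  have nec : ∀ ε : ℝ, ε < b - a → ConsensusPossible G f I ε → TwoReach G f (f + 1) := by
    rintro ε hε ⟨D, A, hA⟩
    exact hA.twoReach hn ha hb (hε.trans_le (by rw [abs_sub_comm]; exact le_abs_self _))
  have suf : ∀ ε : ℝ, 0 < ε → TwoReach G f (f + 1) → ConsensusPossible G f I ε :=
    fun ε hε hG => hG.consensusPossible hn hI hε
  -- Necessity needs only one `ε` in `(0, b - a)`; half of `b - a` is such a choice.
  exact ⟨⟨fun h => nec ((b - a) / 2) (by linarith) (h _ (by linarith)),
    fun hG ε hε => suf ε hε hG⟩, fun ε hε hε' => ⟨nec ε hε', suf ε hε⟩⟩
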